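/- Conventions. All vector spaces are finite-dimensional over $\mathbb{C}$. A tensor $T\in U_1\otimes\cdots\otimes U_m$ is viewed as a multilinear form $T(\alpha_1,\dots,\alpha_m)$ on $U_1^*\times\cdots\times U_m^*$. A tensor $T\in U_1\otimes\cdots\otimes U_m$ \emph{degenerates} to $S\in U_1'\otimes\cdots\otimes U_m'$ if $S$ lies in the (Euclidean) closure of $\{(X_1\otimes\cdots\otimes X_m)T : X_i\in\mathrm{Hom}(U_i,U_i')\}$. The \emph{border subrank} $\underline{\mathrm{Q}}(T)$ is the largest $q$ such that $T$ degenerates to the unit tensor $\sum_{s=1}^q e_s\otimes\cdots\otimes e_s\in(\mathbb{C}^q)^{\otimes m}$. The \emph{geometric rank} $\mathrm{GR}(T)$, computed with respect to the $j$-th factor, is the codimension in $\prod_{i\ne j}U_i^*$ of the affine variety $$\{(\alpha_i)_{i\neq j} : T(\alpha_1,\dots,\alpha_m)=0 \text{ for all } \alpha_j\in U_j^*\}.$$ Let $\mathcal{T}_n$ be the algebra of upper triangular $n\times n$ complex matrices, and let $T^{(k)}_{\mathcal{T}_n}\in\mathcal{T}_n\otimes(\mathcal{T}_n^*)^{\otimes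 k}$ be the tensor of order $k+1$ corresponding to the $k$-fold product $(a_1,\dots,a_k)\mapsto a_1\cdots a_k$, that is, $T^{(k)}_{\mathcal{T}_n}(\varphi,a_1,\dots,a_k)=\varphi(a_1\cdots a_k)$ for $\varphi\in\mathcal{T}_n^*$ and $a_i\in\mathcal{T}_n$. Theorem. Let $n,k\geq 1$ be integers and let $q=\lfloor n/k\rfloor$. Then $$\underline{\mathrm{Q}}\bigl(T^{(k)}_{\mathcal{T}_n}\bigr)=\mathrm{GR}\bigl(T^{(k)}_{\mathcal{T}_n}\bigr)=\frac{(q+1)(2n-qk)}{2},$$ where the geometric rank may be computed with respect to any of the $k+1$ factors. -/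

import Mathlib

/-!
A tensor in `U₁ ⊗ ⋯ ⊗ U_m`, with the `U_i` finite-dimensional complex vector spaces, is treated
as the multilinear form `(α₁, …, α_m) ↦ T(α₁, …, α_m)` on `U₁* × ⋯ × U_m*`. In the definitions
below `V i` stands for the dual space `U_i*`.
-/

namespace TensorRank

universe u v

/-- `T` degenerates to `S`: the tensor `S` lies in the closure of the set of all tensors
`(X₁ ⊗ ⋯ ⊗ X_m) T`, where the `X_i` are linear maps from the factors of `T` to those of `S`.
On multilinear forms, `X₁ ⊗ ⋯ ⊗ X_m` acts by composition with the transposes `W i → V i`.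
The closure is taken for pointwise convergence of forms, which on the finite-dimensional space of
multilinear forms is the Euclidean topology. -/
def Degenerates {m : ℕ} {V : Fin m → Type u} {W : Fin m → Type v}
    [∀ i, AddCommGroup (V i)] [∀ i, Module ℂ (V i)]
    [∀ i, AddCommGroup (W i)] [∀ i, Module ℂ (W i)]
    (T : MultilinearMap ℂ V ℂ) (S : MultilinearMap ℂ W ℂ) : Prop :=
  (S : (∀ i, W i) → ℂ) ∈
    closure {f : (∀ i, W i) → ℂ | ∃ X : ∀ i, W i →ₗ[ℂ] V i, f = T.compLinearMap X}

/-- The unit tensor `∑ₛ eₛ ⊗ ⋯ ⊗ eₛ` of order `m` and rank `r`, that is, the form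
`(x₁, …, x_m) ↦ ∑ₛ x₁(s) ⋯ x_m(s)`. -/
noncomputable def unitTensor (m r : ℕ) : MultilinearMap ℂ (fun _ : Fin m => Fin r → ℂ) ℂ :=
  ∑ s : Fin r, (MultilinearMap.mkPiAlgebra ℂ (Fin m) ℂ).compLinearMap
    (fun _ => (LinearMap.proj s : (Fin r → ℂ) →ₗ[ℂ] ℂ))

/-- `r` is the border subrank of `T`: the largest `q` such that `T` degenerates to the unit
tensor of rank `q`. -/
def IsBorderSubrank {m : ℕ} {V : Fin m → Type u}
    [∀ i, AddCommGroup (V i)] [∀ i, Module ℂ (V i)]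
    (T : MultilinearMap ℂ V ℂ) (r : ℕ) : Prop :=
  IsGreatest {q : ℕ | Degenerates T (unitTensor m q)} r

/-- The ring `ℂ[V]` of polynomial functions on a complex vector space `V`. -/
def polyFun (V : Type u) [AddCommGroup V] [Module ℂ V] : Subalgebra ℂ (V → ℂ) :=
  Algebra.adjoin ℂ (Set.range fun φ : Module.Dual ℂ V => (φ : V → ℂ))

/-- The ideal of polynomial functions vanishing on `Z`. -/
def vanishingIdeal {V : Type u} [AddCommGroup V] [Module ℂ V] (Z : Set V) :
    Ideal (polyFun V) where
  carrier := {f | ∀ z ∈ Z, (f : V → ℂ) z = 0}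
  add_mem' := fun {f g} hf hg z hz => by simp [hf z hz, hg z hz]
  zero_mem' := fun z _ => by simp
  smul_mem' := fun c f hf z hz => by simp [hf z hz]

/-- The codimension in `V` of an affine algebraic variety `Z ⊆ V`: the height of its ideal, which
is the smallest codimension of an irreducible component of `Z`. -/
noncomputable def codim {V : Type u} [AddCommGroup V] [Module ℂ V] (Z : Set V) : ℕ∞ :=
  (vanishingIdeal Z).height

/-- The variety of all tuples `(α_i)_{i ≠ j}` such that `T(α₁, …, α_m) = 0` for all `α_j`. -/
def kernelVariety {m : ℕ} {V : Fin m → Type u}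
    [∀ i, AddCommGroup (V i)] [∀ i, Module ℂ (V i)]
    (T : MultilinearMap ℂ V ℂ) (j : Fin m) : Set (∀ i : {i : Fin m // i ≠ j}, V i) :=
  {α | ∀ x : ∀ i, V i, (∀ i : {i : Fin m // i ≠ j}, x i = α i) → T x = 0}

/-- The geometric rank of `T`, computed with respect to the `j`-th factor. -/
noncomputable def geometricRank {m : ℕ} {V : Fin m → Type u}
    [∀ i, AddCommGroup (V i)] [∀ i, Module ℂ (V i)]
    (T : MultilinearMap ℂ V ℂ) (j : Fin m) : ℕ∞ :=
  codim (kernelVariety T j)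

/-- The duals `A*, A, …, A` of the factors of `A ⊗ A* ⊗ ⋯ ⊗ A*` (with `k` factors `A*`). -/
def Factor (A : Type u) [Ring A] [Algebra ℂ A] (k : ℕ) : Fin (k + 1) → Type u :=
  Fin.cases (Module.Dual ℂ A) (fun _ => A)

instance (A : Type u) [Ring A] [Algebra ℂ A] (k : ℕ) (i : Fin (k + 1)) :
    AddCommGroup (Factor A k i) :=
  Fin.cases (motive := fun i => AddCommGroup (Factor A k i))
    (inferInstanceAs (AddCommGroup (Module.Dual ℂ A)))
    (fun _ => inferInstanceAs (AddCommGroup A)) i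

instance (A : Type u) [Ring A] [Algebra ℂ A] (k : ℕ) (i : Fin (k + 1)) :
    Module ℂ (Factor A k i) :=
  Fin.cases (motive := fun i => Module ℂ (Factor A k i))
    (inferInstanceAs (Module ℂ (Module.Dual ℂ A)))
    (fun _ => inferInstanceAs (Module ℂ A)) i

/-- The `k`-th structure tensor of an associative unital algebra `A`, an element of
`A ⊗ A* ⊗ ⋯ ⊗ A*` of order `k + 1`: the form `(φ, a₁, …, a_k) ↦ φ (a₁ ⋯ a_k)`. -/
noncomputable def structureTensor (A : Type u) [Ring A] [Algebra ℂ A] (k : ℕ) :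
    MultilinearMap ℂ (Factor A k) ℂ :=
  LinearMap.uncurryLeft (M := Factor A k)
    { toFun := fun φ : Module.Dual ℂ A =>
        φ.compMultilinearMap (MultilinearMap.mkPiAlgebraFin ℂ k A)
      map_add' := fun _ _ => rfl
      map_smul' := fun _ _ => rfl }

/-- The algebra of upper triangular complex `n × n` matrices. -/
abbrev UpperTriangular (n : ℕ) : Subalgebra ℂ (Matrix (Fin n) (Fin n) ℂ) :=
  Matrix.blockTriangularSubalgebra ℂ ℂ id

end TensorRank

/-! The value is squeezed between a degeneration and an explicit set of equations.

Lower bound (`degenerates_structureTensor`): for i + k s < n, the functional reading the entry (i, i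
+ k s) and the matrix units along the path i, i + s, ..., i + k s multiply to 1. Other combinations
can be nonzero too, when edges of different paths fit together. Scale the functional by N^(k s^2)
and each matrix unit by N^(-s^2). A path with the same endpoints but unequal steps has a strictly
larger sum of squares, so mixed terms tend to 0. The number of pairs (i, s) is the sum of n - k s
over s ≤ q.

Upper bound (`geometricRank_le`): cut {0, ..., n - 1} into k consecutive intervals. If the l-th
factor vanishes on the l-th diagonal block, then the product vanishes, since a path of nonzero
entries must leave each interval in turn. The codimension is thus at most the number of upper
triangular entries in the blocks. For sizes q and q + 1 this equals the number of pairs (i, s).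

The two meet by `le_geometricRank_of_degenerates`. If T restricts along maps `X i` to a form near
the unit tensor, the Zariski closure of its kernel variety meets the image of x ↦ (X i x) only at 0,
and a cone with this property has codimension at least the dimension of the source (`le_codim`).
This rests on a height estimate proved by Nullstellensatz, a graded Nakayama argument and going
down. -/

namespace TensorRank

universe u

/-! ### Height of the ideal of a cone that meets a linear subspace only at the origin -/

section Height

open Polynomial in
/-- A prime ideal of `A[y₁, …, y_q]` modulo which every `yᵢ` is integral over `A` has height at
least `q`. -/
theorem le_height_of_integral_variables {A : Type*} [CommRing A] [IsNoetherianRing A] (q : ℕ)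
    (P : Ideal (MvPolynomial (Fin q) A)) [P.IsPrime]
    (hP : ∀ i, ∃ g : A[X], g.Monic ∧ aeval (MvPolynomial.X i) g ∈ P) :
    (q : ℕ∞) ≤ P.height := by
  induction q with
  | zero => simp
  | succ q ih =>
    let e := MvPolynomial.finSuccEquiv A q
    let Q : Ideal (MvPolynomial (Fin q) A)[X] := P.comap e.symm.toRingEquiv
    have hQ : Q.height = P.height := RingEquiv.height_comap e.symm.toRingEquiv P
    have hQprime : Q.IsPrime := Ideal.IsPrime.comap _
    have hmem : ∀ (i : Fin (q + 1)) (g : A[X]), aeval (MvPolynomial.X i) g ∈ P →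
        aeval (e (MvPolynomial.X i)) g ∈ Q := by
      intro i g hg
      change e.symm (aeval (e (MvPolynomial.X i)) g) ∈ P
      rwa [← aeval_algHom_apply, AlgEquiv.symm_apply_apply]
    let p := Q.comap (C : MvPolynomial (Fin q) A →+* _)
    have hpprime : p.IsPrime := Ideal.IsPrime.comap _
    have hp : (q : ℕ∞) ≤ p.height := by
      refine ih p fun i => ?_
      obtain ⟨g, hg, hgP⟩ := hP i.succ
      refine ⟨g, hg, ?_⟩
      have h := hmem _ _ hgP
      rw [show e (MvPolynomial.X i.succ) = C (MvPolynomial.X i) from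
        MvPolynomial.finSuccEquiv_X_succ] at h
      change C (aeval (MvPolynomial.X i) g) ∈ Q
      have : C (aeval (MvPolynomial.X i : MvPolynomial (Fin q) A) g) =
          aeval (C (MvPolynomial.X i)) g :=
        (aeval_algHom_apply (Polynomial.CAlgHom (R := A) (A := MvPolynomial (Fin q) A)) _ g).symm
      rwa [this]
    have hmapprime : (p.map (C : MvPolynomial (Fin q) A →+* _)).IsPrime :=
      Ideal.isPrime_map_C_of_isPrime
    -- Adjoining a variable is flat, so going down holds and extending `p` does not lower its
    -- height.
    have hle : p.height ≤ (p.map (C : MvPolynomial (Fin q) A →+* _)).height := by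
      have : (p.map (C : MvPolynomial (Fin q) A →+* _)).LiesOver p := by
        refine ⟨?_⟩
        ext x
        rw [Ideal.under_def, Ideal.mem_comap (K := p.map C), algebraMap_eq,
          Ideal.mem_map_C_iff]
        constructor
        · intro hx n
          rw [coeff_C]
          split_ifs
          exacts [hx, p.zero_mem]
        · intro h
          simpa using h 0
      rw [Ideal.height_eq_height_add_of_liesOver_of_hasGoingDown p
        (p.map (C : MvPolynomial (Fin q) A →+* _))]
      exact le_self_add
    -- `Q` contains a polynomial monic in the new variable; in the extension of `p` its leading
    -- coefficient 1 would lie in `p`.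
    have hlt : p.map (C : MvPolynomial (Fin q) A →+* _) < Q := by
      refine lt_of_le_of_ne (Ideal.map_comap_le) fun heq => ?_
      obtain ⟨g, hg, hgP⟩ := hP 0
      have h := hmem _ _ hgP
      rw [show e (MvPolynomial.X 0) = X from MvPolynomial.finSuccEquiv_X_zero] at h
      rw [aeval_X_left_eq_map, ← heq, Ideal.mem_map_C_iff] at h
      have h1 := h (g.map (algebraMap A (MvPolynomial (Fin q) A))).natDegree
      rw [coeff_natDegree, (hg.map _).leadingCoeff] at h1
      exact hpprime.ne_top ((Ideal.eq_top_iff_one _).2 h1)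
    rw [← hQ]
    push_cast
    exact (add_le_add_left (hp.trans hle) 1).trans
      (Ideal.height_add_one_le_of_lt_of_isPrime hlt)

open MvPolynomial in
/-- If `S` is the quotient of `ℂ[y, z]` by a homogeneous ideal and the `yᵢ` are nilpotent in
`S / (z)`, then `S` is finite over `ℂ[z]`. -/
theorem finite_of_pow_mem {σ τ : Type*} [Finite σ] [Finite τ] {S : Type*} [CommRing S]
    (π : MvPolynomial (σ ⊕ τ) ℂ →+* S) (hπ : Function.Surjective π)
    (hhom : ∀ f, π f = 0 → ∀ d, π (homogeneousComponent d f) = 0) (M : ℕ)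
    (hM : ∀ i : σ, (X (Sum.inl i) : MvPolynomial (σ ⊕ τ) ℂ) ^ M ∈
      RingHom.ker π ⊔ Ideal.span (X '' Set.range Sum.inr)) :
    (π.comp
      (rename Sum.inr : MvPolynomial τ ℂ →ₐ[ℂ] MvPolynomial (σ ⊕ τ) ℂ).toRingHom).Finite := by
  classical
  let φ := π.comp
      (rename Sum.inr : MvPolynomial τ ℂ →ₐ[ℂ] MvPolynomial (σ ⊕ τ) ℂ).toRingHom
  let : Algebra (MvPolynomial τ ℂ) S := φ.toAlgebra
  have hsmul : ∀ (a : MvPolynomial τ ℂ) (x : MvPolynomial (σ ⊕ τ) ℂ),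
      a • π x = π (rename Sum.inr a * x) := by
    intro a x
    rw [Algebra.smul_def, map_mul]
    rfl
  let B : Set ((σ ⊕ τ) →₀ ℕ) := Set.Icc 0 (Finsupp.equivFunOnFinite.symm fun _ => M)
  let N : Submodule (MvPolynomial τ ℂ) S :=
    Submodule.span _ ((fun s => π (monomial s 1)) '' B)
  have hC : ∀ (c : ℂ) (x : MvPolynomial (σ ⊕ τ) ℂ), π x ∈ N →
      π (C c * x) ∈ N := by
    intro c x hx
    have := N.smul_mem (C c) hx
    rwa [hsmul, rename_C] at this
  have hsum : ∀ f : MvPolynomial (σ ⊕ τ) ℂ,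
      (∀ s ∈ f.support, π (monomial s 1) ∈ N) → π f ∈ N := by
    intro f hf
    rw [f.as_sum, map_sum]
    refine N.sum_mem fun s hs => ?_
    have := hC (f.coeff s) _ (hf s hs)
    rwa [C_mul_monomial, mul_one] at this
  -- Graded Nakayama, by induction on the degree. A monomial divisible by some z is z times one of
  -- lower degree. One divisible by yᵢ^M is congruent, modulo the kernel, to a combination of
  -- monomials of the same degree each divisible by some z. All others lie in the finite box `B`.
  have key : ∀ (d : ℕ) (s : (σ ⊕ τ) →₀ ℕ), s.degree = d →
      π (monomial s 1) ∈ N := by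
    intro d
    induction d using Nat.strong_induction_on with
    | _ d ih =>
      have hinr : ∀ s : (σ ⊕ τ) →₀ ℕ, s.degree = d → ∀ l, s (Sum.inr l) ≠ 0 →
          π (monomial s 1) ∈ N := by
        intro s hs l hl
        have hle : Finsupp.single (Sum.inr l) 1 ≤ s := by
          rw [Finsupp.single_le_iff]
          omega
        obtain ⟨u, rfl⟩ := exists_add_of_le hle
        rw [map_add, Finsupp.degree_single] at hs
        have hu := N.smul_mem (X l) (ih u.degree (by omega) u rfl)
        rw [hsmul, rename_X, X, monomial_mul, one_mul] at hu
        exact hu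
      intro s hs
      by_cases hB : s ∈ B
      · exact Submodule.subset_span ⟨s, hB, rfl⟩
      by_cases hr : ∃ l, s (Sum.inr l) ≠ 0
      · obtain ⟨l, hl⟩ := hr
        exact hinr s hs l hl
      push Not at hr
      obtain ⟨i, hi⟩ : ∃ i, M ≤ s (Sum.inl i) := by
        by_contra hcon
        push Not at hcon
        refine hB ⟨zero_le, fun x => ?_⟩
        rcases x with i | l
        · exact (hcon i).le
        · simp [hr l]
      have hle : Finsupp.single (Sum.inl i) M ≤ s := by
        rwa [Finsupp.single_le_iff]
      obtain ⟨u, rfl⟩ := exists_add_of_le hle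
      rw [map_add, Finsupp.degree_single] at hs
      obtain ⟨f, hf, g, hg, hfg⟩ := Submodule.mem_sup.1 (hM i)
      -- Taking degree-M components keeps the rewriting homogeneous, so that the induction on the
      -- degree applies.
      have hX : (X (Sum.inl i) ^ M : MvPolynomial (σ ⊕ τ) ℂ) =
          homogeneousComponent M f + homogeneousComponent M g := by
        rw [← map_add, hfg, homogeneousComponent_eq_self]
        exact isHomogeneous_X_pow _ _
      have hmono : (monomial (Finsupp.single (Sum.inl i) M + u) 1 : MvPolynomial (σ ⊕ τ) ℂ) =
          homogeneousComponent M f * monomial u 1 + homogeneousComponent M g * monomial u 1 := by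
        rw [← add_mul, ← hX, X_pow_eq_monomial, monomial_mul, one_mul]
      rw [hmono, map_add, map_mul, hhom f hf M, zero_mul,
        zero_add]
      have hgu : homogeneousComponent M g * monomial u 1 ∈
          (Ideal.span (X '' Set.range Sum.inr) : Ideal (MvPolynomial (σ ⊕ τ) ℂ)) := by
        refine Ideal.mul_mem_right _ _ ?_
        rw [mem_ideal_span_X_image] at hg ⊢
        intro m hm
        refine hg m ?_
        rw [support_homogeneousComponent] at hm
        exact (Finset.mem_filter.1 hm).1
      have hdeg : (homogeneousComponent M g * monomial u 1).IsHomogeneous d := by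
        rw [← hs]
        exact (homogeneousComponent_isHomogeneous M g).mul (isHomogeneous_monomial _ rfl)
      refine hsum _ fun m hm => ?_
      obtain ⟨_, ⟨l, rfl⟩, hl⟩ := mem_ideal_span_X_image.1 hgu m hm
      refine hinr m ?_ l hl
      have := hdeg (mem_support_iff.1 hm)
      rwa [Finsupp.degree_eq_weight_one]
  have hN : N = ⊤ := by
    refine Submodule.eq_top_iff'.2 fun x => ?_
    obtain ⟨f, rfl⟩ := hπ x
    exact hsum f fun s _ => key _ s rfl
  exact ⟨hN ▸ Submodule.fg_span ((Set.finite_Icc _ _).image _)⟩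

open MvPolynomial in
-- Finiteness over ℂ[z] makes each yᵢ integral modulo I, hence modulo every minimal prime over I.
theorem le_height_of_pow_mem {q : ℕ} {τ : Type*} [Finite τ]
    (I : Ideal (MvPolynomial (Fin q ⊕ τ) ℂ))
    (hhom : ∀ f ∈ I, ∀ d, homogeneousComponent d f ∈ I) (M : ℕ)
    (hM : ∀ i : Fin q, (X (Sum.inl i) : MvPolynomial (Fin q ⊕ τ) ℂ) ^ M ∈
      I ⊔ Ideal.span (X '' Set.range Sum.inr)) :
    (q : ℕ∞) ≤ I.height := by
  have hfin := finite_of_pow_mem (Ideal.Quotient.mk I) Ideal.Quotient.mk_surjective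
    (fun f hf d => Ideal.Quotient.eq_zero_iff_mem.2
      (hhom f (Ideal.Quotient.eq_zero_iff_mem.1 hf) d)) M (by rwa [Ideal.mk_ker])
  rw [Ideal.height_eq_inf_minimalPrimes]
  refine le_iInf₂ fun P hP => ?_
  have hPprime : P.IsPrime := hP.1.1
  let e := (sumRingEquiv ℂ (Fin q) τ).symm
  have hprime : (P.comap e).IsPrime := Ideal.IsPrime.comap _
  rw [← RingEquiv.height_comap e P]
  refine le_height_of_integral_variables q _ fun i => ?_
  obtain ⟨g, hg, hgi⟩ := hfin.to_isIntegral (Ideal.Quotient.mk I (X (Sum.inl i)))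
  refine ⟨g, hg, hP.1.2 ?_⟩
  rw [← Polynomial.hom_eval₂, Ideal.Quotient.eq_zero_iff_mem] at hgi
  have he : (e : MvPolynomial (Fin q) (MvPolynomial τ ℂ) →+* MvPolynomial (Fin q ⊕ τ) ℂ).comp
      (algebraMap (MvPolynomial τ ℂ) _) =
      (rename Sum.inr : MvPolynomial τ ℂ →ₐ[ℂ] MvPolynomial (Fin q ⊕ τ) ℂ).toRingHom := by
    refine MvPolynomial.ringHom_ext (fun r => ?_) (fun l => ?_)
    · simp [e, algebraMap_eq]
    · simp [e, algebraMap_eq]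
  have h := Polynomial.hom_eval₂ g (algebraMap (MvPolynomial τ ℂ) _)
    (e : MvPolynomial (Fin q) (MvPolynomial τ ℂ) →+* MvPolynomial (Fin q ⊕ τ) ℂ) (X i)
  rw [he] at h
  change e (Polynomial.eval₂ (algebraMap (MvPolynomial τ ℂ) _) _ g) ∈ I
  simp only [RingHom.coe_coe] at h
  rw [h]
  simpa [e] using hgi

open MvPolynomial in
theorem aeval_smul_of_isHomogeneous {σ : Type*} {f : MvPolynomial σ ℂ} {d : ℕ}
    (hf : f.IsHomogeneous d) (t : ℂ) (x : σ → ℂ) :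
    aeval (t • x) f = t ^ d * aeval x f := by
  simp only [aeval_eq_eval, eval_eq, Finset.mul_sum]
  refine Finset.sum_congr rfl fun s hs => ?_
  have hd : ∑ i ∈ s.support, s i = d := hf.degree_eq_sum_deg_support hs ▸ rfl
  simp only [Pi.smul_apply, smul_eq_mul, mul_pow, Finset.prod_mul_distrib,
    Finset.prod_pow_eq_pow_sum, hd]
  ring

open MvPolynomial in
theorem homogeneousComponent_mem_vanishingIdeal {σ : Type*} {Z : Set (σ → ℂ)}
    (hZ : ∀ (t : ℂ), ∀ x ∈ Z, t • x ∈ Z) {f : MvPolynomial σ ℂ}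
    (hf : f ∈ MvPolynomial.vanishingIdeal ℂ Z) (d : ℕ) :
    homogeneousComponent d f ∈ MvPolynomial.vanishingIdeal ℂ Z := by
  intro x hx
  -- This is t ↦ f(t x), which vanishes identically because Z is a cone; its coefficients are the
  -- values of the components of f.
  let p : Polynomial ℂ := ∑ i ∈ Finset.range (f.totalDegree + 1),
    Polynomial.monomial i (aeval x (homogeneousComponent i f))
  have hp : p = 0 := by
    refine Polynomial.funext fun t => ?_
    have h := hf _ (hZ t x hx)
    rw [← sum_homogeneousComponent f, map_sum] at h
    rw [Polynomial.eval_finsetSum, Polynomial.eval_zero, ← h]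
    refine Finset.sum_congr rfl fun i _ => ?_
    rw [Polynomial.eval_monomial]
    rw [aeval_smul_of_isHomogeneous (homogeneousComponent_isHomogeneous i f), mul_comm]
  rcases lt_or_ge f.totalDegree d with h | h
  · rw [homogeneousComponent_eq_zero d f h, map_zero]
  · have := congrArg (Polynomial.coeff · d) hp
    simpa [p, Polynomial.finsetSum_coeff, Polynomial.coeff_monomial, h, Nat.lt_succ_iff]
      using this

open MvPolynomial in
-- The Nullstellensatz turns the geometric hypothesis on the Zariski closure of Z into the statement
-- that a power of each yᵢ lies in I + (z).
theorem le_height_vanishingIdeal {q : ℕ} {τ : Type*} [Finite τ] (Z : Set (Fin q ⊕ τ → ℂ))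
    (hcone : ∀ (t : ℂ), ∀ x ∈ Z, t • x ∈ Z)
    (hZ : ∀ x ∈ zeroLocus ℂ (MvPolynomial.vanishingIdeal ℂ Z),
      (∀ l, x (Sum.inr l) = 0) → x = 0) :
    (q : ℕ∞) ≤ (MvPolynomial.vanishingIdeal ℂ Z).height := by
  set I := MvPolynomial.vanishingIdeal ℂ Z with hI
  set K : Ideal (MvPolynomial (Fin q ⊕ τ) ℂ) := I ⊔ Ideal.span (X '' Set.range Sum.inr) with hK
  have hrad : ∀ i : Fin q, (X (Sum.inl i) : MvPolynomial (Fin q ⊕ τ) ℂ) ∈ K.radical := by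
    intro i
    rw [← vanishingIdeal_zeroLocus_eq_radical (K := ℂ)]
    intro x hx
    have h0 : x = 0 := by
      refine hZ x (fun p hp => hx p (Ideal.mem_sup_left hp)) fun l => ?_
      have := hx (X (Sum.inr l)) (Ideal.mem_sup_right (Ideal.subset_span ⟨_, ⟨l, rfl⟩, rfl⟩))
      simpa using this
    simp [h0]
  choose M hM using hrad
  refine le_height_of_pow_mem I (fun f hf d => homogeneousComponent_mem_vanishingIdeal hcone hf d)
    (∑ i, M i) fun i => ?_
  exact K.pow_mem_of_pow_mem (hM i) (Finset.single_le_sum (fun _ _ => Nat.zero_le _)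
    (Finset.mem_univ i))

end Height

/-! ### Codimension bounds in coordinates -/

section Codim

variable {V : Type*} [AddCommGroup V] [Module ℂ V]

theorem dual_mem_polyFun (φ : Module.Dual ℂ V) : (φ : V → ℂ) ∈ polyFun V :=
  Algebra.subset_adjoin ⟨φ, rfl⟩

theorem const_mem_polyFun (c : ℂ) : (fun _ : V => c) ∈ polyFun V :=
  (polyFun V).algebraMap_mem c

/-- The polynomial function with given expression in the coordinates of a basis. -/
noncomputable def polyFunOfBasis {ι : Type*} (b : Module.Basis ι ℂ V) :
    MvPolynomial ι ℂ →ₐ[ℂ] polyFun V :=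
  MvPolynomial.aeval fun i => ⟨b.coord i, dual_mem_polyFun (b.coord i)⟩

theorem polyFunOfBasis_apply {ι : Type*} (b : Module.Basis ι ℂ V) (p : MvPolynomial ι ℂ) (v : V) :
    (polyFunOfBasis b p : V → ℂ) v = MvPolynomial.aeval (b.repr v) p := by
  let ev : polyFun V →ₐ[ℂ] ℂ := (Pi.evalAlgHom ℂ (fun _ : V => ℂ) v).comp (polyFun V).val
  have : ev.comp (polyFunOfBasis b) = MvPolynomial.aeval (b.repr v) := by
    refine MvPolynomial.algHom_ext fun i => ?_
    simp [ev, polyFunOfBasis]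
  exact DFunLike.congr_fun this p

/-- Injectivity holds because ℂ is infinite; surjectivity because every linear form is a linear
polynomial in the coordinates. -/
theorem polyFunOfBasis_bijective {ι : Type*} [Finite ι] (b : Module.Basis ι ℂ V) :
    Function.Bijective (polyFunOfBasis b) := by
  cases nonempty_fintype ι
  constructor
  · rw [injective_iff_map_eq_zero]
    intro p hp
    refine MvPolynomial.funext fun x => ?_
    have h := polyFunOfBasis_apply b p (b.equivFun.symm x)
    have hx : ⇑(b.repr (b.equivFun.symm x)) = x := by
      rw [← b.equivFun_apply, LinearEquiv.apply_symm_apply]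
    rw [hp, hx] at h
    simpa using h.symm
  · have hle : polyFun V ≤ ((polyFun V).val.comp (polyFunOfBasis b)).range := by
      refine Algebra.adjoin_le ?_
      rintro _ ⟨φ, rfl⟩
      refine ⟨∑ i, MvPolynomial.C (φ (b i)) * MvPolynomial.X i, ?_⟩
      ext v
      change (polyFunOfBasis b _ : V → ℂ) v = φ v
      rw [polyFunOfBasis_apply]
      have hv : φ v = ∑ i, b.repr v i * φ (b i) := by
        conv_lhs => rw [← b.sum_repr v, map_sum]
        simp only [map_smul, smul_eq_mul]
      simp [hv, mul_comm]
    rintro ⟨f, hf⟩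
    obtain ⟨p, hp⟩ := hle hf
    exact ⟨p, Subtype.ext hp⟩

theorem codim_eq_height {ι : Type*} [Finite ι] (b : Module.Basis ι ℂ V) (Z : Set V) :
    codim Z = (MvPolynomial.vanishingIdeal ℂ ((fun v => ⇑(b.repr v)) '' Z)).height := by
  let e := (AlgEquiv.ofBijective _ (polyFunOfBasis_bijective b)).toRingEquiv
  rw [codim, ← RingEquiv.height_comap e]
  congr 1
  ext p
  rw [Ideal.mem_comap, MvPolynomial.mem_vanishingIdeal_iff, Set.forall_mem_image]
  refine forall₂_congr fun v _ => ?_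
  rw [← polyFunOfBasis_apply]
  rfl

/-- A cone `Z` which meets the image of a linear map from `ℂ^q` only in the origin has
codimension at least `q`. -/
theorem le_codim [FiniteDimensional ℂ V] {q : ℕ} (Z : Set V) (h0 : 0 ∈ Z)
    (hcone : ∀ (t : ℂ), ∀ z ∈ Z, t • z ∈ Z) (Λ : (Fin q → ℂ) →ₗ[ℂ] V)
    (hΛ : ∀ x, x ≠ 0 → ∃ f ∈ vanishingIdeal Z, (f : V → ℂ) (Λ x) ≠ 0) :
    (q : ℕ∞) ≤ codim Z := by
  have hinj : Function.Injective Λ := by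
    rw [injective_iff_map_eq_zero]
    intro x hx
    by_contra hne
    obtain ⟨f, hf, hfx⟩ := hΛ x hne
    exact hfx (hx ▸ hf 0 h0)
  -- In a basis adapted to this decomposition, the image of `Λ` is the locus z = 0.
  obtain ⟨C, hC⟩ := Submodule.exists_isCompl (LinearMap.range Λ)
  let b : Module.Basis (Fin q ⊕ Fin (Module.finrank ℂ C)) ℂ V :=
    (((Pi.basisFun ℂ (Fin q)).map (LinearEquiv.ofInjective Λ hinj)).prod
      (Module.finBasis ℂ C)).map (Submodule.prodEquivOfIsCompl _ _ hC)
  have hb : ∀ i, b (Sum.inl i) = Λ (Pi.single i 1) := by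
    intro i
    simp [b]
  rw [codim_eq_height b]
  refine le_height_vanishingIdeal _ ?_ ?_
  · rintro t _ ⟨z, hz, rfl⟩
    exact ⟨t • z, hcone t z hz, by ext; simp⟩
  · intro x hx hr
    by_contra hne
    let y : Fin q → ℂ := fun i => x (Sum.inl i)
    have hy : y ≠ 0 := by
      intro hy
      refine hne (funext fun j => ?_)
      rcases j with i | l
      · exact congrFun hy i
      · exact hr l
    have hrepr : ⇑(b.repr (Λ y)) = x := by
      have : Λ y = b.equivFun.symm x := by
        rw [b.equivFun_symm_apply, Fintype.sum_sum_type]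
        simp only [hr, zero_smul, Finset.sum_const_zero, add_zero, hb]
        simp only [← map_smul, ← map_sum]
        congr 1
        ext i
        simp [y, Pi.single_apply]
      rw [this, ← b.equivFun_apply, LinearEquiv.apply_symm_apply]
    obtain ⟨f, hf, hfx⟩ := hΛ y hy
    obtain ⟨p, rfl⟩ := (polyFunOfBasis_bijective b).2 f
    rw [polyFunOfBasis_apply, hrepr] at hfx
    refine hfx (hx p ?_)
    rintro _ ⟨z, hz, rfl⟩
    rw [← polyFunOfBasis_apply]
    exact hf z hz

/-- A set which contains the common zeros of `r` polynomial functions without constant term has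
codimension at most `r`. -/
theorem codim_le [FiniteDimensional ℂ V] {κ : Type*} [Fintype κ] (Z : Set V) (F : κ → V → ℂ)
    (hF : ∀ i, F i ∈ polyFun V) (h0 : ∀ i, F i 0 = 0) (hZ : ∀ v, (∀ i, F i v = 0) → v ∈ Z) :
    codim Z ≤ Fintype.card κ := by
  classical
  let b := Module.finBasis ℂ V
  rw [codim_eq_height b]
  choose p hp using fun i => (polyFunOfBasis_bijective b).2 ⟨F i, hF i⟩
  have hpF : ∀ i v, MvPolynomial.aeval (b.repr v) (p i) = F i v := by
    intro i v
    rw [← polyFunOfBasis_apply, hp]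
  let s : Finset (MvPolynomial (Fin (Module.finrank ℂ V)) ℂ) := Finset.univ.image p
  let J : Ideal (MvPolynomial (Fin (Module.finrank ℂ V)) ℂ) := Ideal.span s
  -- The common zero at the origin makes `J` proper, so it has a minimal prime, whose height Krull's
  -- theorem bounds by the number of generators.
  have hJ : J ≠ ⊤ := by
    have hle : J ≤ MvPolynomial.vanishingIdeal ℂ {(b.repr (0 : V) : _ → ℂ)} := by
      refine Ideal.span_le.2 fun f hf => ?_
      obtain ⟨i, _, rfl⟩ := Finset.mem_image.1 hf
      rw [SetLike.mem_coe, MvPolynomial.mem_vanishingIdeal_singleton_iff, hpF, h0]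
    intro htop
    rw [htop, top_le_iff, Ideal.eq_top_iff_one, MvPolynomial.mem_vanishingIdeal_singleton_iff,
      map_one] at hle
    exact one_ne_zero hle
  obtain ⟨P, hP⟩ := Ideal.nonempty_minimalPrimes hJ
  have hPprime : P.IsPrime := hP.1.1
  calc _ ≤ P.height := Ideal.height_mono ?_
    _ ≤ s.card := Ideal.height_le_card_of_mem_minimalPrimes_span_finset hP
    _ ≤ Fintype.card κ := by exact_mod_cast Finset.card_image_le
  refine le_trans ?_ (hPprime.radical_le_iff.2 hP.1.2)
  rw [← MvPolynomial.vanishingIdeal_zeroLocus_eq_radical (K := ℂ)]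
  refine MvPolynomial.vanishingIdeal_anti_mono fun x hx => ?_
  have hrepr : ⇑(b.repr (b.equivFun.symm x)) = x := by
    rw [← b.equivFun_apply, LinearEquiv.apply_symm_apply]
  refine ⟨b.equivFun.symm x, hZ _ fun i => ?_, hrepr⟩
  rw [← hpF, hrepr]
  exact hx _ (Ideal.subset_span (Finset.mem_image_of_mem p (Finset.mem_univ i)))

theorem multilinear_mem_polyFun {m : ℕ} {U : Fin m → Type*} [∀ i, AddCommGroup (U i)]
    [∀ i, Module ℂ (U i)] [∀ i, FiniteDimensional ℂ (U i)] (T : MultilinearMap ℂ U ℂ)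
    (x : V → ∀ i, U i) (hx : ∀ i (φ : Module.Dual ℂ (U i)), (fun v => φ (x v i)) ∈ polyFun V) :
    (fun v => T (x v)) ∈ polyFun V := by
  let b := fun i => Module.finBasis ℂ (U i)
  have h : (fun v => T (x v)) = ∑ r : ∀ i, Fin (Module.finrank ℂ (U i)),
      (∏ i, fun v => (b i).coord (r i) (x v i)) * fun _ => T fun i => b i (r i) := by
    ext v
    have hv : x v = fun i => ∑ j, (b i).coord j (x v i) • b i j :=
      funext fun i => ((b i).sum_repr (x v i)).symm
    conv_lhs => rw [hv, T.map_sum]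
    simp [T.map_smul_univ, Finset.sum_apply, Finset.prod_apply]
  rw [h]
  exact sum_mem fun r _ => mul_mem (prod_mem fun i _ => hx i _) (const_mem_polyFun _)

end Codim

/-! ### Border subrank is at most geometric rank -/

section Degeneration

theorem unitTensor_apply (m r : ℕ) (x : Fin m → Fin r → ℂ) :
    unitTensor m r x = ∑ s, ∏ i, x i s := by
  simp [unitTensor]

theorem multilinear_apply_eq_sum {m r : ℕ} (f : MultilinearMap ℂ (fun _ : Fin m => Fin r → ℂ) ℂ)
    (x : Fin m → Fin r → ℂ) :
    f x = ∑ s : Fin m → Fin r, (∏ i, x i (s i)) * f fun i => Pi.single (s i) 1 := by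
  have hx : x = fun i => ∑ j, x i j • (Pi.single j 1 : Fin r → ℂ) := by
    ext i j
    simp [Pi.single_apply]
  conv_lhs => rw [hx, f.map_sum]
  simp [f.map_smul_univ]

/-- A form close to the unit tensor does not vanish on tuples of vectors whose `s`-th coordinates
are dominant, one of them being the basis vector `e_s`. -/
theorem ne_zero_of_close {m q : ℕ} (f : MultilinearMap ℂ (fun _ : Fin m => Fin q → ℂ) ℂ)
    (ε : ℝ) (hε : (q : ℝ) ^ m * ε < 1)
    (hf : ∀ r : Fin m → Fin q,
      ‖f (fun i => Pi.single (r i) 1) - unitTensor m q (fun i => Pi.single (r i) 1)‖ ≤ ε)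
    (x : Fin m → Fin q → ℂ) (s : Fin q) (hs : ∀ i, x i s ≠ 0) (hx : ∀ i u, ‖x i u‖ ≤ ‖x i s‖)
    (j : Fin m) (hj : ∀ u, u ≠ s → x j u = 0) : f x ≠ 0 := by
  intro h0
  have hunit : unitTensor m q x = ∏ i, x i s := by
    rw [unitTensor_apply]
    refine Finset.sum_eq_single s (fun u _ hu => ?_) (by simp)
    exact Finset.prod_eq_zero (Finset.mem_univ j) (hj u hu)
  have hpos : 0 < ∏ i, ‖x i s‖ := Finset.prod_pos fun i _ => norm_pos_iff.2 (hs i)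
  -- Each of the q^m terms of the expansion in basis vectors contributes at most ε times the product
  -- of the dominant coordinates, which is the absolute value of the unit tensor at x.
  have hle : ‖(f - unitTensor m q) x‖ ≤ (q : ℝ) ^ m * ε * ∏ i, ‖x i s‖ := by
    rw [multilinear_apply_eq_sum]
    calc _ ≤ ∑ r : Fin m → Fin q, ε * ∏ i, ‖x i s‖ := ?_
      _ = _ := by simp [mul_assoc]
    refine norm_sum_le_of_le _ fun r _ => ?_
    rw [norm_mul, norm_prod, mul_comm]
    have h1 := hf r
    exact mul_le_mul h1 (Finset.prod_le_prod (fun _ _ => norm_nonneg _) fun i _ => hx i _)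
      (Finset.prod_nonneg fun _ _ => norm_nonneg _) ((norm_nonneg _).trans h1)
  rw [_root_.sub_apply, h0, hunit, zero_sub, norm_neg, norm_prod] at hle
  nlinarith

theorem smul_mem_kernelVariety {m : ℕ} {V : Fin m → Type u} [∀ i, AddCommGroup (V i)]
    [∀ i, Module ℂ (V i)] (T : MultilinearMap ℂ V ℂ) (j : Fin m) (t : ℂ)
    (α : ∀ i : {i : Fin m // i ≠ j}, V i) (hα : α ∈ kernelVariety T j) :
    t • α ∈ kernelVariety T j := by
  classical
  intro x hx
  let y : ∀ i, V i := fun i => if h : i = j then x i else α ⟨i, h⟩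
  have hxy : x = fun i => (if i = j then 1 else t) • y i := by
    ext i
    by_cases h : i = j
    · simp [h, y]
    · simp [h, y, hx ⟨i, h⟩]
  rw [hxy, T.map_smul_univ, hα y fun i => by simp [y, i.2], smul_zero]

/-- Completing a tuple indexed by `i ≠ j` by an entry at `j`. -/
def insertAt {m : ℕ} {V : Fin m → Type u} (j : Fin m) (c : V j)
    (α : ∀ i : {i : Fin m // i ≠ j}, V i) (i : Fin m) : V i :=
  if h : i = j then h ▸ c else α ⟨i, h⟩

theorem insertAt_self {m : ℕ} {V : Fin m → Type u} (j : Fin m) (c : V j)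
    (α : ∀ i : {i : Fin m // i ≠ j}, V i) : insertAt j c α j = c := by
  simp [insertAt]

theorem insertAt_ne {m : ℕ} {V : Fin m → Type u} (j : Fin m) (c : V j)
    (α : ∀ i : {i : Fin m // i ≠ j}, V i) (i : {i : Fin m // i ≠ j}) :
    insertAt j c α i = α i := by
  simp [insertAt, i.2]

theorem insertAt_mem_polyFun {m : ℕ} {V : Fin m → Type u} [∀ i, AddCommGroup (V i)]
    [∀ i, Module ℂ (V i)] [∀ i, FiniteDimensional ℂ (V i)]
    (T : MultilinearMap ℂ V ℂ) (j : Fin m) (c : V j) :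
    (fun α => T (insertAt j c α)) ∈ polyFun (∀ i : {i : Fin m // i ≠ j}, V i) := by
  refine multilinear_mem_polyFun T _ fun i φ => ?_
  by_cases h : i = j
  · subst h
    simp only [insertAt_self]
    exact const_mem_polyFun _
  · simp only [insertAt_ne j c _ ⟨i, h⟩]
    exact dual_mem_polyFun (φ ∘ₗ (LinearMap.proj (⟨i, h⟩ : {i : Fin m // i ≠ j}) :
      (∀ i : {i : Fin m // i ≠ j}, V i) →ₗ[ℂ] V i))

/-- The border subrank is at most the geometric rank. -/
theorem le_geometricRank_of_degenerates {m : ℕ} (hm : 2 ≤ m) {V : Fin m → Type u}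
    [∀ i, AddCommGroup (V i)] [∀ i, Module ℂ (V i)] [∀ i, FiniteDimensional ℂ (V i)]
    (T : MultilinearMap ℂ V ℂ) {q : ℕ} (hT : Degenerates T (unitTensor m q)) (j : Fin m) :
    (q : ℕ∞) ≤ geometricRank T j := by
  classical
  obtain ⟨ε, hε, hqε⟩ : ∃ ε : ℝ, 0 < ε ∧ (q : ℝ) ^ m * ε < 1 := by
    refine ⟨((q : ℝ) ^ m + 1)⁻¹, by positivity, ?_⟩
    rw [← div_eq_mul_inv, div_lt_one (by positivity)]
    linarith
  obtain ⟨X, hX⟩ : ∃ X : ∀ i, (Fin q → ℂ) →ₗ[ℂ] V i, ∀ r : Fin m → Fin q,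
      ‖T.compLinearMap X (fun i => Pi.single (r i) 1) -
        unitTensor m q (fun i => Pi.single (r i) 1)‖ ≤ ε := by
    let O : Set ((Fin m → Fin q → ℂ) → ℂ) := {g | ∀ r : Fin m → Fin q,
      ‖g (fun i => Pi.single (r i) 1) - unitTensor m q (fun i => Pi.single (r i) 1)‖ < ε}
    have hO : IsOpen O := by
      simp only [O, Set.ofPred_forall]
      exact isOpen_iInter_of_finite fun r => isOpen_lt (by fun_prop) continuous_const
    obtain ⟨_, hg, X, rfl⟩ := mem_closure_iff.1 hT O hO fun r => by simpa using hε
    exact ⟨X, fun r => (hg r).le⟩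
  refine le_codim _ ?_ (smul_mem_kernelVariety T j)
    (LinearMap.pi fun i : {i : Fin m // i ≠ j} => X i) fun x hx => ?_
  · intro y hy
    have : Nontrivial (Fin m) := Fin.nontrivial_iff_two_le.2 hm
    obtain ⟨i, hi⟩ := exists_ne j
    exact T.map_coord_zero i (hy ⟨i, hi⟩)
  · obtain ⟨i₀, hi₀⟩ := Function.ne_iff.1 hx
    have : Nonempty (Fin q) := ⟨i₀⟩
    -- Inserting `X j` of e_s at slot j gives a polynomial function that vanishes on the kernel
    -- variety. It is nonzero at the image of x because the s-th coordinate of x is dominant.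
    obtain ⟨s, hs⟩ := Finite.exists_max fun u => ‖x u‖
    have hxs : x s ≠ 0 := norm_pos_iff.1 ((norm_pos_iff.2 hi₀).trans_le (hs i₀))
    let y : Fin m → Fin q → ℂ := fun i => if i = j then Pi.single s 1 else x
    refine ⟨⟨_, insertAt_mem_polyFun T j (X j (Pi.single s 1))⟩, fun α hα => ?_, ?_⟩
    · exact hα _ fun i => insertAt_ne j _ α i
    · have hne := ne_zero_of_close (T.compLinearMap X) ε hqε hX y s
        (fun i => by by_cases h : i = j <;> simp [y, h, hxs])
        (fun i u => by
          by_cases h : i = j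
          · by_cases hu : u = s <;> simp [y, h, hu]
          · simpa [y, h] using hs u) j
        (fun u hu => by simp [y, hu])
      convert hne using 1
      rw [MultilinearMap.compLinearMap_apply]
      refine congrArg T (funext fun i => ?_)
      by_cases h : i = j
      · subst h
        simp [insertAt_self, y]
      · rw [insertAt_ne j _ _ ⟨i, h⟩]
        simp [y, h]

/-- Degeneration to the unit tensor can be checked on tuples of basis vectors. -/
theorem degenerates_unitTensor {m r : ℕ} {V : Fin m → Type u} [∀ i, AddCommGroup (V i)]
    [∀ i, Module ℂ (V i)] (T : MultilinearMap ℂ V ℂ) (X : ℕ → ∀ i, (Fin r → ℂ) →ₗ[ℂ] V i)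
    (hX : ∀ s : Fin m → Fin r, Filter.Tendsto
      (fun N => T fun i => X N i (Pi.single (s i) 1)) Filter.atTop
      (nhds (unitTensor m r fun i => Pi.single (s i) 1))) :
    Degenerates T (unitTensor m r) := by
  refine mem_closure_of_tendsto (b := Filter.atTop) (f := fun N => ⇑(T.compLinearMap (X N)))
    (tendsto_pi_nhds.2 fun x => ?_) (Filter.Eventually.of_forall fun N => ⟨X N, rfl⟩)
  simp only [multilinear_apply_eq_sum _ x]
  exact tendsto_finsetSum _ fun s _ => (hX s).const_mul _

end Degeneration

/-! ### Upper bound from diagonal blocks -/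

section UpperTriangular

instance (A : Type u) [Ring A] [Algebra ℂ A] [FiniteDimensional ℂ A] (k : ℕ) (i : Fin (k + 1)) :
    FiniteDimensional ℂ (Factor A k i) :=
  Fin.cases (motive := fun i => FiniteDimensional ℂ (Factor A k i))
    (inferInstanceAs (FiniteDimensional ℂ (Module.Dual ℂ A)))
    (fun _ => inferInstanceAs (FiniteDimensional ℂ A)) i

/-- The first factor of `Factor A k` is the dual of `A`. -/
def factorZero (A : Type u) [Ring A] [Algebra ℂ A] (k : ℕ) :
    Factor A k 0 ≃ₗ[ℂ] Module.Dual ℂ A :=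
  LinearEquiv.refl ℂ (Module.Dual ℂ A)

/-- The other factors of `Factor A k` are equal to `A`. -/
def factorSucc (A : Type u) [Ring A] [Algebra ℂ A] {k : ℕ} (l : Fin k) :
    Factor A k l.succ ≃ₗ[ℂ] A :=
  LinearEquiv.refl ℂ A

theorem structureTensor_apply (A : Type u) [Ring A] [Algebra ℂ A] (k : ℕ)
    (x : ∀ i, Factor A k i) :
    structureTensor A k x =
      factorZero A k (x 0) (List.ofFn fun l : Fin k => factorSucc A l (x l.succ)).prod :=
  rfl

variable {n : ℕ}

theorem coe_prod_ofFn {k : ℕ} (a : Fin k → UpperTriangular n) :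
    ((List.ofFn a).prod : Matrix (Fin n) (Fin n) ℂ) =
      (List.ofFn fun l => (a l : Matrix (Fin n) (Fin n) ℂ)).prod := by
  have h := map_list_prod (UpperTriangular n).val (List.ofFn a)
  rwa [List.map_ofFn] at h

theorem upperTriangular_apply_eq_zero (a : UpperTriangular n) {p q : Fin n} (h : q < p) :
    (a : Matrix (Fin n) (Fin n) ℂ) p q = 0 :=
  a.2 h

/-- A nonzero entry of a product of matrices is witnessed by a path of nonzero entries. -/
theorem exists_path_of_prod_ne_zero {k : ℕ} (M : Fin k → Matrix (Fin n) (Fin n) ℂ) (a b : Fin n)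
    (h : (List.ofFn M).prod a b ≠ 0) :
    ∃ p : Fin (k + 1) → Fin n, p 0 = a ∧ p (Fin.last k) = b ∧
      ∀ l : Fin k, M l (p l.castSucc) (p l.succ) ≠ 0 := by
  induction k generalizing a with
  | zero =>
    have hab : a = b := by
      by_contra hne
      exact h (by simp [Matrix.one_apply_ne hne])
    exact ⟨fun _ => a, rfl, hab, fun l => l.elim0⟩
  | succ k ih =>
    rw [List.ofFn_succ, List.prod_cons, Matrix.mul_apply] at h
    obtain ⟨c, _, hc⟩ := Finset.exists_ne_zero_of_sum_ne_zero h
    obtain ⟨p, hp0, hpl, hp⟩ := ih (fun l => M l.succ) c (right_ne_zero_of_mul hc)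
    refine ⟨Fin.cons a p, rfl, by rw [← Fin.succ_last, Fin.cons_succ, hpl], fun l => ?_⟩
    refine Fin.cases ?_ (fun l => ?_) l
    · simpa [hp0] using left_ne_zero_of_mul hc
    · rw [← Fin.succ_castSucc, Fin.cons_succ, Fin.cons_succ]
      exact hp l

theorem prod_single_apply {k : ℕ} (p : Fin (k + 1) → Fin n) :
    (List.ofFn fun l : Fin k =>
      (Matrix.single (p l.castSucc) (p l.succ) 1 : Matrix (Fin n) (Fin n) ℂ)).prod
        (p 0) (p (Fin.last k)) = 1 := by
  induction k with
  | zero => simp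
  | succ k ih =>
    rw [List.ofFn_succ, List.prod_cons, Fin.castSucc_zero, Matrix.single_mul_apply_same, one_mul]
    exact ih fun i => p i.succ

/-- The matrix unit with entry `1` at `(p, q)` if `p ≤ q`, and `0` otherwise. -/
noncomputable def matrixUnit (p q : Fin n) : UpperTriangular n :=
  if h : p ≤ q then ⟨Matrix.single p q 1, Matrix.blockTriangular_single h 1⟩ else 0

theorem coe_matrixUnit {p q : Fin n} (h : p ≤ q) :
    (matrixUnit p q : Matrix (Fin n) (Fin n) ℂ) = Matrix.single p q 1 := by
  simp [matrixUnit, h]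

theorem sum_smul_matrixUnit (a : UpperTriangular n) :
    a = ∑ p, ∑ q, (a : Matrix (Fin n) (Fin n) ℂ) p q • matrixUnit p q := by
  refine Subtype.ext ?_
  conv_lhs => rw [Matrix.matrix_eq_sum_single (a : Matrix (Fin n) (Fin n) ℂ)]
  rw [AddSubmonoidClass.coe_finsetSum]
  refine Finset.sum_congr rfl fun p _ => ?_
  rw [AddSubmonoidClass.coe_finsetSum]
  refine Finset.sum_congr rfl fun q _ => ?_
  rcases le_or_gt p q with h | h
  · rw [Subalgebra.coe_smul, coe_matrixUnit h, Matrix.smul_single, smul_eq_mul, mul_one]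
  · simp [upperTriangular_apply_eq_zero a h]

/-- The functional on upper triangular matrices reading off an entry. -/
noncomputable def entryDual (p q : Fin n) : Module.Dual ℂ (UpperTriangular n) :=
  Matrix.entryLinearMap ℂ ℂ p q ∘ₗ (UpperTriangular n).val.toLinearMap

theorem entryDual_apply (p q : Fin n) (a : UpperTriangular n) :
    entryDual p q a = (a : Matrix (Fin n) (Fin n) ℂ) p q :=
  rfl

/-- A product of upper triangular matrices vanishes if the `l`-th one vanishes on the diagonal
block `[c l, c (l + 1))`, for a partition `0 = c 0 ≤ ⋯ ≤ c k = n`. -/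
theorem prod_eq_zero_of_blocks {k : ℕ} (c : ℕ → ℕ) (hc0 : c 0 = 0) (hck : c k = n)
    (a : Fin k → UpperTriangular n)
    (ha : ∀ (l : Fin k) (p q : Fin n), c l ≤ p → p ≤ q → (q : ℕ) < c (l + 1) →
      (a l : Matrix (Fin n) (Fin n) ℂ) p q = 0) :
    (List.ofFn a).prod = 0 := by
  refine Subtype.ext (Matrix.ext fun u v => ?_)
  by_contra hne
  rw [coe_prod_ofFn] at hne
  obtain ⟨p, -, -, hp⟩ := exists_path_of_prod_ne_zero _ u v hne
  -- The l-th step cannot stay inside the l-th interval, so the path would end at or beyond n.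
  have hle : ∀ l : Fin (k + 1), c l ≤ p l := by
    intro l
    induction l using Fin.induction with
    | zero => simp [hc0]
    | succ l ih =>
      by_contra hlt
      push Not at hlt
      refine hp l (ha l _ _ ih ?_ hlt)
      by_contra hgt
      exact hp l (upperTriangular_apply_eq_zero (a l) (not_le.1 hgt))
  have := hle (Fin.last k)
  rw [Fin.val_last, hck] at this
  exact absurd (p (Fin.last k)).2 (not_lt.2 this)

/-- The index set of the entries in the diagonal blocks of sizes `c (l + 1) - c l`. -/
abbrev BlockIndex (k : ℕ) (c : ℕ → ℕ) : Type :=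
  (l : Fin k) × (q : Fin (c (l + 1) - c l)) × Fin (q + 1)

theorem structureTensor_update_eq_zero {k : ℕ} (l₀ : Fin k)
    (x : ∀ i, Factor (UpperTriangular n) k i)
    (h : ∀ p q : Fin n, p ≤ q → structureTensor (UpperTriangular n) k
      (Function.update x l₀.succ ((factorSucc _ l₀).symm (matrixUnit p q))) = 0) :
    structureTensor (UpperTriangular n) k x = 0 := by
  let L : UpperTriangular n →ₗ[ℂ] ℂ :=
    (structureTensor (UpperTriangular n) k).toLinearMap x l₀.succ ∘ₗ
      (factorSucc (UpperTriangular n) l₀).symm.toLinearMap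
  have hL : L (factorSucc _ l₀ (x l₀.succ)) =
      structureTensor (UpperTriangular n) k x := by
    simp [L]
  rw [← hL, sum_smul_matrixUnit (factorSucc _ l₀ (x l₀.succ)), map_sum]
  refine Finset.sum_eq_zero fun p _ => ?_
  rw [map_sum]
  refine Finset.sum_eq_zero fun q _ => ?_
  rw [map_smul]
  rcases le_or_gt p q with hpq | hpq
  · rw [show L (matrixUnit p q) = 0 from h p q hpq, smul_zero]
  · rw [upperTriangular_apply_eq_zero _ hpq, zero_smul]

/-- Each block entry gives one equation. If its matrix is among the variables, the equation says
that this entry is zero. If its matrix is the omitted factor, the equation says that T vanishes with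
the corresponding matrix unit inserted; matrix units outside the block need no equation. Hence the
count does not depend on j. -/
theorem geometricRank_le (k : ℕ) (c : ℕ → ℕ) (hc : Monotone c) (hc0 : c 0 = 0) (hck : c k = n)
    (j : Fin (k + 1)) :
    geometricRank (structureTensor (UpperTriangular n) k) j ≤ Fintype.card (BlockIndex k c) := by
  classical
  have hlt : ∀ (l : Fin k) (q : ℕ), q < c (l + 1) - c l → c l + q < n := by
    intro l q hq
    have h1 : c (l + 1) ≤ c k := hc l.2
    omega
  let row : BlockIndex k c → Fin n := fun t =>
    ⟨c t.1 + t.2.2, hlt t.1 _ (by have := t.2.1.2; have := t.2.2.2; omega)⟩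
  let col : BlockIndex k c → Fin n := fun t => ⟨c t.1 + t.2.1, hlt t.1 _ t.2.1.2⟩
  have hidx : ∀ (l : Fin k) (p q : Fin n), c l ≤ p → p ≤ q → (q : ℕ) < c (l + 1) →
      ∃ t : BlockIndex k c, t.1 = l ∧ row t = p ∧ col t = q := by
    intro l p q hp hpq hq
    have hpq' : (p : ℕ) ≤ q := hpq
    refine ⟨⟨l, ⟨q - c l, by omega⟩, ⟨p - c l, by dsimp only; omega⟩⟩, rfl, Fin.ext ?_, Fin.ext ?_⟩
    · dsimp only [row]; omega
    · dsimp only [col]; omega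
  let F : BlockIndex k c → (∀ i : {i // i ≠ j}, Factor (UpperTriangular n) k i) → ℂ := fun t =>
    if h : t.1.succ = j then fun α => structureTensor (UpperTriangular n) k
      (insertAt j (h ▸ (factorSucc _ t.1).symm (matrixUnit (row t) (col t))) α)
    else fun α => entryDual (row t) (col t) (factorSucc _ t.1 (α ⟨t.1.succ, h⟩))
  refine codim_le _ F (fun t => ?_) (fun t => ?_) fun α hα x hx => ?_
  · by_cases h : t.1.succ = j
    · simp only [F, h, dite_true]
      exact insertAt_mem_polyFun _ j _
    · simp only [F, h, dite_false]
      let P : (∀ i : {i // i ≠ j}, Factor (UpperTriangular n) k i) →ₗ[ℂ] UpperTriangular n :=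
        (factorSucc _ t.1).toLinearMap ∘ₗ LinearMap.proj (⟨t.1.succ, h⟩ : {i // i ≠ j})
      exact dual_mem_polyFun (entryDual (row t) (col t) ∘ₗ P)
  · by_cases h : t.1.succ = j
    · simp only [F, h, dite_true]
      have h0 : (0 : Fin (k + 1)) ≠ j := h ▸ (Fin.succ_ne_zero t.1).symm
      exact MultilinearMap.map_coord_zero _ 0 (insertAt_ne j _ 0 ⟨0, h0⟩)
    · simp only [F, h, dite_false]
      exact map_zero (entryDual (row t) (col t))
  · have hkill : ∀ (l : Fin k) (p q : Fin n), l.succ ≠ j → c l ≤ p → p ≤ q → (q : ℕ) < c (l + 1) →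
        (factorSucc (UpperTriangular n) l (x l.succ) : Matrix (Fin n) (Fin n) ℂ) p q = 0 := by
      intro l p q hl hp hpq hq
      obtain ⟨t, rfl, rfl, rfl⟩ := hidx l p q hp hpq hq
      have h := hα t
      simp only [F, hl, dite_false] at h
      rw [hx ⟨t.1.succ, hl⟩]
      exact h
    induction j using Fin.cases with
    | zero =>
      rw [structureTensor_apply, prod_eq_zero_of_blocks c hc0 hck _ fun l p q =>
        hkill l p q (Fin.succ_ne_zero l), map_zero]
    | succ l₀ =>
      refine structureTensor_update_eq_zero l₀ x fun p q hpq => ?_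
      by_cases hblock : c l₀ ≤ p ∧ (q : ℕ) < c (l₀ + 1)
      · obtain ⟨t, rfl, rfl, rfl⟩ := hidx l₀ p q hblock.1 hpq hblock.2
        have h := hα t
        simp only [F, dite_true] at h
        convert h using 2
        ext i
        by_cases hi : i = t.1.succ
        · subst hi
          rw [Function.update_self, insertAt_self]
        · rw [Function.update_of_ne hi, insertAt_ne _ _ _ ⟨i, hi⟩]
          exact hx ⟨i, hi⟩
      · rw [structureTensor_apply, prod_eq_zero_of_blocks c hc0 hck, map_zero]
        intro l p' q' hp' hpq' hq'
        by_cases hl : l = l₀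
        · subst hl
          rw [Function.update_self, LinearEquiv.apply_symm_apply, coe_matrixUnit hpq]
          refine Matrix.single_apply_of_ne _ _ _ _ _ ?_
          rintro ⟨rfl, rfl⟩
          exact hblock ⟨hp', hq'⟩
        · have hl' : l.succ ≠ l₀.succ := fun h => hl (Fin.succ_injective _ h)
          rw [Function.update_of_ne hl']
          exact hkill l p' q' hl' hp' hpq' hq'

end UpperTriangular

/-! ### Degeneration to the unit tensor along paths with equal steps -/

section EqualSteps

theorem unitTensor_single_of_const {m r : ℕ} (a : Fin (m + 1) → Fin r) (h : ∀ i, a i = a 0) :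
    (unitTensor (m + 1) r fun i => Pi.single (a i) 1) = 1 := by
  rw [unitTensor_apply, Finset.sum_eq_single (a 0)]
  · simp [h]
  · intro u _ hu
    exact Finset.prod_eq_zero (Finset.mem_univ 0) (by simp [hu])
  · simp

theorem unitTensor_single_of_ne {m r : ℕ} (a : Fin (m + 1) → Fin r) (i : Fin (m + 1))
    (h : a i ≠ a 0) : (unitTensor (m + 1) r fun i => Pi.single (a i) 1) = 0 := by
  rw [unitTensor_apply]
  refine Finset.sum_eq_zero fun u _ => ?_
  by_cases hu : u = a 0
  · exact Finset.prod_eq_zero (Finset.mem_univ i) (by simp [hu, h.symm])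
  · exact Finset.prod_eq_zero (Finset.mem_univ 0) (by simp [hu])

/-- Among the sequences of `k` steps leading from `i₀` to `i₀ + k s₀`, the sum of the squares of
the steps is smallest for equal steps. -/
theorem lt_sum_sq_of_steps {k : ℕ} (p : Fin (k + 1) → ℕ) (s : Fin k → ℕ) (s₀ : ℕ)
    (hp : ∀ l : Fin k, p l.succ = p l.castSucc + s l)
    (hlast : p (Fin.last k) = p 0 + k * s₀) (hne : ∃ l, s l ≠ s₀) :
    k * s₀ ^ 2 < ∑ l, s l ^ 2 := by
  have hsum : ∑ l, (s l : ℤ) = k * s₀ := by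
    have h : ∀ l : Fin k, (s l : ℤ) = (p l.succ : ℤ) - p l.castSucc := by
      intro l
      rw [hp l]
      push_cast
      ring
    have h2 := Fin.sum_univ_succ fun i => (p i : ℤ)
    have h3 := Fin.sum_univ_castSucc fun i => (p i : ℤ)
    simp only [h, Finset.sum_sub_distrib]
    rw [hlast] at h3
    push_cast at h3
    linarith
  -- Since the average step is s₀, the sum of squared deviations is the difference of the two sides.
  have hpos : 0 < ∑ l, ((s l : ℤ) - s₀) ^ 2 := by
    obtain ⟨l, hl⟩ := hne
    refine Finset.sum_pos' (fun _ _ => sq_nonneg _) ⟨l, Finset.mem_univ l, ?_⟩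
    have : (s l : ℤ) - s₀ ≠ 0 := by
      rw [sub_ne_zero]
      exact_mod_cast hl
    positivity
  have hexp : ∑ l, ((s l : ℤ) - s₀) ^ 2 = ∑ l, (s l : ℤ) ^ 2 - k * (s₀ : ℤ) ^ 2 := by
    have : ∀ l, ((s l : ℤ) - s₀) ^ 2 = (s l : ℤ) ^ 2 - 2 * s₀ * s l + (s₀ : ℤ) ^ 2 := fun l => by
      ring
    simp only [this, Finset.sum_add_distrib, Finset.sum_sub_distrib, ← Finset.mul_sum, hsum]
    simp
    ring
  rw [hexp] at hpos
  zify
  linarith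

variable {n k r : ℕ}

/-- The vectors spanning the restriction of the structure tensor to the paths with equal steps
`i a, i a + s a, …, i a + k * s a`. -/
noncomputable def stepVector (i s : Fin r → ℕ) (h : ∀ a, i a + k * s a < n) :
    ∀ j : Fin (k + 1), Fin r → Factor (UpperTriangular n) k j :=
  have hlt : ∀ a l, l ≤ k → i a + l * s a < n := fun a _ hl =>
    (Nat.add_le_add_left (Nat.mul_le_mul_right _ hl) _).trans_lt (h a)
  Fin.cases
    (fun a => (factorZero _ k).symm
      (entryDual ⟨i a, (Nat.le_add_right _ _).trans_lt (h a)⟩ ⟨i a + k * s a, h a⟩))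
    (fun l a => (factorSucc _ l).symm
      (matrixUnit ⟨i a + l * s a, hlt a l l.2.le⟩ ⟨i a + (l + 1) * s a, hlt a (l + 1) l.2⟩))

/-- A nonzero mixed value forces the edges to concatenate: the l-th edge comes from the path of `a
l.succ`, the endpoints from that of `a 0`. -/
theorem exists_path_of_stepVector (i s : Fin r → ℕ) (h : ∀ a, i a + k * s a < n)
    (a : Fin (k + 1) → Fin r)
    (hne : (structureTensor (UpperTriangular n) k fun j => stepVector i s h j (a j)) ≠ 0) :
    ∃ p : Fin (k + 1) → ℕ, p 0 = i (a 0) ∧ p (Fin.last k) = i (a 0) + k * s (a 0) ∧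
      ∀ l : Fin k, p l.castSucc = i (a l.succ) + l * s (a l.succ) ∧
        p l.succ = i (a l.succ) + (l + 1) * s (a l.succ) := by
  rw [structureTensor_apply] at hne
  simp only [stepVector, Fin.cases_zero, Fin.cases_succ, LinearEquiv.apply_symm_apply,
    entryDual_apply] at hne
  rw [coe_prod_ofFn] at hne
  obtain ⟨p, hp0, hpl, hp⟩ := exists_path_of_prod_ne_zero _ _ _ hne
  refine ⟨fun j => p j, by simp [hp0], by simp [hpl], fun l => ?_⟩
  have hl := hp l
  rw [coe_matrixUnit (by rw [Fin.le_def]; dsimp only; gcongr; omega)] at hl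
  by_contra hcon
  refine hl (Matrix.single_apply_of_ne _ _ _ _ _ fun heq => hcon ?_)
  exact ⟨(congrArg Fin.val heq.1).symm, (congrArg Fin.val heq.2).symm⟩

theorem structureTensor_stepVector_const (i s : Fin r → ℕ) (h : ∀ a, i a + k * s a < n)
    (a : Fin r) :
    (structureTensor (UpperTriangular n) k fun j => stepVector i s h j a) = 1 := by
  let p : Fin (k + 1) → Fin n := fun l => ⟨i a + l * s a,
    (Nat.add_le_add_left (Nat.mul_le_mul_right _ (Nat.lt_succ_iff.1 l.2)) _).trans_lt (h a)⟩
  have hp := prod_single_apply p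
  rw [structureTensor_apply]
  simp only [stepVector, Fin.cases_zero, Fin.cases_succ, LinearEquiv.apply_symm_apply,
    entryDual_apply]
  rw [coe_prod_ofFn]
  have h0 : p 0 = ⟨i a, (Nat.le_add_right _ _).trans_lt (h a)⟩ := Fin.ext (by simp [p])
  rw [h0] at hp
  refine Eq.trans (congrArg (fun L : List (Matrix (Fin n) (Fin n) ℂ) => L.prod _ _)
    (congrArg List.ofFn (funext fun l => ?_))) hp
  rw [coe_matrixUnit (by rw [Fin.le_def]; dsimp only; gcongr; omega)]
  rfl

theorem degenerates_structureTensor (i s : Fin r → ℕ) (h : ∀ a, i a + k * s a < n)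
    (hinj : ∀ a b, i a = i b → s a = s b → a = b) :
    Degenerates (structureTensor (UpperTriangular n) k) (unitTensor (k + 1) r) := by
  -- The weights cancel on constant tuples; in general the exponent is k s(a 0)^2 minus the sum of
  -- the s(a l.succ)^2. The base N + 1 is never zero.
  let w : ℕ → Fin (k + 1) → Fin r → ℂ := fun N => Fin.cases
    (fun a => ((N : ℂ) + 1) ^ (k * s a ^ 2)) (fun _ a => (((N : ℂ) + 1) ^ (s a ^ 2))⁻¹)
  refine degenerates_unitTensor _ (fun N j => Fintype.linearCombination ℂ
    fun a => w N j a • stepVector i s h j a) fun a => ?_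
  have hval : ∀ N, (structureTensor (UpperTriangular n) k fun j =>
      Fintype.linearCombination ℂ (fun a => w N j a • stepVector i s h j a)
        (Pi.single (a j) 1)) = ((N : ℂ) + 1) ^ (k * s (a 0) ^ 2) *
        (((N : ℂ) + 1) ^ (∑ l : Fin k, s (a l.succ) ^ 2))⁻¹ *
        structureTensor (UpperTriangular n) k fun j => stepVector i s h j (a j) := by
    intro N
    simp only [Fintype.linearCombination_apply_single, one_smul]
    rw [MultilinearMap.map_smul_univ, Fin.prod_univ_succ, smul_eq_mul]
    simp [w, Finset.prod_pow_eq_pow_sum]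
  simp only [hval]
  have hN : ∀ N : ℕ, (N : ℂ) + 1 ≠ 0 := fun N => by exact_mod_cast N.succ_ne_zero
  by_cases hconst : ∀ j, a j = a 0
  · rw [unitTensor_single_of_const a hconst]
    refine tendsto_const_nhds.congr fun N => ?_
    simp only [hconst, structureTensor_stepVector_const, mul_one, Finset.sum_const,
      Finset.card_univ, Fintype.card_fin, smul_eq_mul]
    rw [mul_inv_cancel₀ (pow_ne_zero _ (hN N))]
  · push Not at hconst
    obtain ⟨j, hj⟩ := hconst
    rw [unitTensor_single_of_ne a j hj]
    by_cases hzero : (structureTensor (UpperTriangular n) k fun j => stepVector i s h j (a j)) = 0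
    · simp only [hzero, mul_zero]
      exact tendsto_const_nhds
    · obtain ⟨p, hp0, hpl, hp⟩ := exists_path_of_stepVector i s h a hzero
      have hstep : ∀ l : Fin k, p l.succ = p l.castSucc + s (a l.succ) := fun l => by
        rw [(hp l).1, (hp l).2]
        ring
      -- If all steps were equal to s(a 0), the glued path would be the progression of `a 0`.
      -- Comparing positions, every edge would have the same i and s, and `a` would be constant.
      have hlt := lt_sum_sq_of_steps p (fun l => s (a l.succ)) (s (a 0)) hstep (hp0 ▸ hpl) <| by
        by_contra! hs
        have hpath : ∀ l : Fin (k + 1), p l = i (a 0) + l * s (a 0) := by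
          intro l
          induction l using Fin.induction with
          | zero => simp [hp0]
          | succ l ih =>
            rw [hstep, ih, hs l, Fin.val_castSucc, Fin.val_succ]
            ring
        refine hj ?_
        induction j using Fin.cases with
        | zero => rfl
        | succ l =>
          refine hinj _ _ ?_ (hs l)
          have h1 := (hp l).1
          rw [hpath, hs l, Fin.val_castSucc] at h1
          omega
      obtain ⟨d, hd⟩ := Nat.exists_eq_add_of_lt hlt
      rw [← zero_mul (structureTensor (UpperTriangular n) k fun j => stepVector i s h j (a j))]
      refine Filter.Tendsto.mul_const _ ?_
      have hlim : Filter.Tendsto (fun N : ℕ => (((N : ℂ) + 1)⁻¹) ^ (d + 1)) Filter.atTop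
          (nhds 0) := by
        have h1 : Filter.Tendsto (fun N : ℕ => ((N : ℂ) + 1)⁻¹) Filter.atTop (nhds 0) := by
          simpa using tendsto_one_div_add_atTop_nhds_zero_nat (𝕜 := ℂ)
        simpa using h1.pow (d + 1)
      refine hlim.congr fun N => ?_
      rw [hd, add_assoc, pow_add _ (k * s (a 0) ^ 2), mul_inv, ← mul_assoc,
        mul_inv_cancel₀ (pow_ne_zero _ (hN N)),
        one_mul, inv_pow]

end EqualSteps

/-! ### Counting block entries and equal-step paths -/

section Counting

theorem two_mul_sum_fin_succ (d : ℕ) : 2 * ∑ p : Fin d, ((p : ℕ) + 1) = d * (d + 1) := by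
  induction d with
  | zero => simp
  | succ d ih =>
    rw [Fin.sum_univ_castSucc, mul_add]
    simp only [Fin.val_castSucc, Fin.val_last]
    rw [ih]
    ring

theorem two_mul_card_blockIndex (n k q : ℕ) (c : ℕ → ℕ) (hc0 : c 0 = 0)
    (hck : c k = n) (hstep : ∀ l, c (l + 1) = c l + q ∨ c (l + 1) = c l + q + 1) :
    2 * (Fintype.card (BlockIndex k c) : ℤ) = (q + 1) * (2 * n - q * k) := by
  have hcard : 2 * Fintype.card (BlockIndex k c) =
      ∑ l : Fin k, (c (l + 1) - c l) * (c (l + 1) - c l + 1) := by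
    simp only [BlockIndex, Fintype.card_sigma, Fintype.card_fin, Finset.mul_sum (Finset.univ)
      (fun l : Fin k => ∑ p : Fin (c (l + 1) - c l), ((p : ℕ) + 1)), two_mul_sum_fin_succ]
  -- The function d(d + 1) agrees with the linear function (2q + 2)d - q(q + 1) at d = q and d = q +
  -- 1, so the sum telescopes and depends only on n, k and q.
  have hterm : ∀ l : ℕ, (((c (l + 1) - c l) * (c (l + 1) - c l + 1) : ℕ) : ℤ) =
      (2 * q + 2) * ((c (l + 1) : ℤ) - c l) - q * (q + 1) := by
    intro l
    rcases hstep l with h | h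
    · rw [h, Nat.add_sub_cancel_left]
      push_cast
      ring
    · rw [h, add_assoc, Nat.add_sub_cancel_left]
      push_cast
      ring
  rw [← Nat.cast_ofNat, ← Nat.cast_mul, hcard, Nat.cast_sum,
    Finset.sum_congr rfl fun (l : Fin k) _ => hterm l, Fin.sum_univ_eq_sum_range
    (fun l => (2 * (q : ℤ) + 2) * ((c (l + 1) : ℤ) - c l) - q * (q + 1)) k,
    Finset.sum_sub_distrib, ← Finset.mul_sum, Finset.sum_range_sub (fun l => (c l : ℤ)), hck, hc0]
  simp
  ring

theorem two_mul_sum_arith (n k q : ℕ) (h : k * q ≤ n) :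
    2 * ((∑ s : Fin (q + 1), (n - k * s) : ℕ) : ℤ) = (q + 1) * (2 * n - q * k) := by
  induction q with
  | zero => simp
  | succ q ih =>
    rw [Fin.sum_univ_castSucc]
    simp only [Fin.val_castSucc, Fin.val_last]
    have h' : k * q ≤ n := (Nat.mul_le_mul_left _ (Nat.le_succ q)).trans h
    rw [Nat.cast_add, mul_add, ih h', Nat.cast_sub h]
    push_cast
    ring

end Counting

end TensorRank

theorem mainTheorem3 (n k : ℕ) (hn : 1 ≤ n) (hk : 1 ≤ k) (q : ℕ) (hq : q = n / k) :
    ∃ r : ℕ, (r : ℚ) = ((q : ℚ) + 1) * (2 * (n : ℚ) - (q : ℚ) * (k : ℚ)) / 2 ∧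
      TensorRank.IsBorderSubrank
        (TensorRank.structureTensor (TensorRank.UpperTriangular n) k) r ∧
      ∀ j : Fin (k + 1),
        TensorRank.geometricRank
          (TensorRank.structureTensor (TensorRank.UpperTriangular n) k) j = (r : ℕ∞) := by
  have hkq : k * q ≤ n := hq ▸ Nat.mul_div_le n k
  -- A pair (s, i) with i < n - k s encodes the path starting at i with step s.
  obtain ⟨r, e, htwo⟩ : ∃ (r : ℕ) (_ : ((s : Fin (q + 1)) × Fin (n - k * s)) ≃ Fin r),
      2 * (r : ℤ) = (q + 1) * (2 * n - q * k) :=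
    ⟨_, finSigmaFinEquiv, TensorRank.two_mul_sum_arith n k q hkq⟩
  have hdeg : TensorRank.Degenerates
      (TensorRank.structureTensor (TensorRank.UpperTriangular n) k)
      (TensorRank.unitTensor (k + 1) r) := by
    refine TensorRank.degenerates_structureTensor (fun a => (e.symm a).2) (fun a => (e.symm a).1)
      (fun a => ?_) fun a b hi hs => e.symm.injective ?_
    · have := (e.symm a).2.2
      omega
    · generalize e.symm a = x at hi hs
      generalize e.symm b = y at hi hs
      obtain ⟨s, i⟩ := x
      obtain ⟨s', i'⟩ := y
      obtain rfl : s = s' := Fin.ext hs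
      obtain rfl : i = i' := Fin.ext hi
      rfl
  have hle : ∀ j, TensorRank.geometricRank
      (TensorRank.structureTensor (TensorRank.UpperTriangular n) k) j ≤ (r : ℕ∞) := by
    intro j
    -- The most balanced partition: the first n mod k blocks have size q + 1, the others size q.
    let c : ℕ → ℕ := fun l => l * q + min l (n % k)
    have hstep : ∀ l, c (l + 1) = c l + q ∨ c (l + 1) = c l + q + 1 := by
      intro l
      simp only [c, Nat.succ_mul]
      omega
    have hc : Monotone c := monotone_nat_of_le_succ fun l => by
      rcases hstep l with h | h <;> omega
    have hc0 : c 0 = 0 := by simp [c]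
    have hck : c k = n := by
      simp only [c, min_eq_right (Nat.mod_lt n hk).le, hq]
      exact Nat.div_add_mod n k
    have hcard := TensorRank.two_mul_card_blockIndex n k q c hc0 hck hstep
    have hr : Fintype.card (TensorRank.BlockIndex k c) = r := by
      have : (Fintype.card (TensorRank.BlockIndex k c) : ℤ) = r := by linarith
      exact_mod_cast this
    exact hr ▸ TensorRank.geometricRank_le k c hc hc0 hck j
  have hge : ∀ {q' : ℕ}, TensorRank.Degenerates
      (TensorRank.structureTensor (TensorRank.UpperTriangular n) k)
      (TensorRank.unitTensor (k + 1) q') → ∀ j, (q' : ℕ∞) ≤ TensorRank.geometricRank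
      (TensorRank.structureTensor (TensorRank.UpperTriangular n) k) j := fun h j =>
    TensorRank.le_geometricRank_of_degenerates (by omega) _ h j
  refine ⟨r, ?_, ⟨hdeg, fun q' h => ?_⟩, fun j => le_antisymm (hle j) (hge hdeg j)⟩
  · have : (2 : ℚ) * r = (q + 1) * (2 * n - q * k) := by exact_mod_cast htwo
    linarith
  · exact_mod_cast (hge h 0).trans (hle 0)
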